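/- For $m,n\in\mathbb N$ let $\sigma:\mathbb R^{m\times n}\to\mathbb R^{\min\{m,n\}}$ map a matrix to the vector of its singular values (with multiplicity), and let $\|X\|_1=\sum_i\sigma_i(X)$ be the nuclear norm. Let $\alpha_t\ge 0$, $\beta>0$, $D\ge 0$, and define $$\psi_t(x)=\alpha_t\sum_{i=1}^{\min\{m,n\}}\Bigl((|x_i|+\beta)\ln\bigl(\tfrac{|x_i|}{\beta}+1\bigr)-|x_i|\Bigr),\qquad x\in\mathbb R^{\min\{m,n\}},$$ and $\Psi_t=\psi_t\circ\sigma:\mathbb R^{m\times n}\to\mathbb R$. Then $\Psi_t$ is $\eta$-strongly convex with respect to the nuclear norm over the nuclear ball $\mathcal K=\{X\in\mathbb R^{m\times n}:\|X\|_1\le D\}$, where $$\eta=\frac{\alpha_t}{2(D+\min\{m,n\}\beta)}$$ (read as $0$ in the degenerate case where the denominator is $0$, that is $\min\{m,n\}=0$ and $D=0$). This means: $\mathcal K$ is convex, $\Psi_t$ is convex on $\mathcal K$, and for every $Y\in\mathcal K$ the subdifferential $\partial\Psi_t(Y)$, the set of linear functionals $G$ on $\mathbb R^{m\times n}$ with $\Psi_t(X)-\Psi_t(Y)\ge\langle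 G,X-Y\rangle$ for all $X\in\mathcal K$, is non-empty, and $$\Psi_t(X)-\Psi_t(Y)\ \ge\ \langle G,X-Y\rangle+\frac{\eta}{2}\,\|X-Y\|_1^2\qquad\text{for all } X,Y\in\mathcal K \text{ and all } G\in\partial\Psi_t(Y).$$ -/

import Mathlib

noncomputable section

namespace SpectralReg

/-- The entropy-like regulariser on `ℝ^d` with parameters `α` and `β`:
`x ↦ α ∑ i, ((|x i| + β) ln (|x i| / β + 1) - |x i|)`. -/
def psi {d : ℕ} (α β : ℝ) (x : Fin d → ℝ) : ℝ :=
  α * ∑ i, ((|x i| + β) * Real.log (|x i| / β + 1) - |x i|)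

/-- The vector of the `min m n` singular values of a real `m × n` matrix, in decreasing order and
with multiplicity: the singular values of the linear map `ℝ^n → ℝ^m`, `v ↦ X v`, between Euclidean
spaces. -/
def sigma {m n : ℕ} (X : Matrix (Fin m) (Fin n) ℝ) : Fin (min m n) → ℝ :=
  fun i => (Matrix.toEuclideanLin X).singularValues i

/-- The spectral regulariser `Ψ = ψ ∘ σ` on real `m × n` matrices. -/
def Psi {m n : ℕ} (α β : ℝ) : Matrix (Fin m) (Fin n) ℝ → ℝ :=
  psi α β ∘ sigma

/-- The nuclear norm: the sum of the singular values. -/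
def nuclearNorm {m n : ℕ} (X : Matrix (Fin m) (Fin n) ℝ) : ℝ :=
  ∑ i, sigma X i

/-- The closed nuclear-norm ball of radius `D` centred at `0`. -/
def nuclearBall (m n : ℕ) (D : ℝ) : Set (Matrix (Fin m) (Fin n) ℝ) :=
  {X | nuclearNorm X ≤ D}

/-- The subdifferential at `y` of `f`, regarded as a function on `K`: all linear functionals `g`
with `f x - f y ≥ ⟨g, x - y⟩` for all `x ∈ K`. -/
def subdifferential {E : Type*} [AddCommGroup E] [Module ℝ E] (K : Set E) (f : E → ℝ) (y : E) :
    Set (Module.Dual ℝ E) :=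
  {g | ∀ x ∈ K, f x - f y ≥ g (x - y)}

/-- `f` is `η`-strongly convex with respect to the norm `N` over `K`: it is a convex function on the
convex set `K`, it has a subgradient at every point of `K`, and
`f x - f y ≥ ⟨g, x - y⟩ + (η / 2) N (x - y) ^ 2` for all `x, y ∈ K` and every subgradient `g` of
`f` at `y`. The norm is an explicit argument because the space carries several. -/
def StronglyConvexWrt {E : Type*} [AddCommGroup E] [Module ℝ E] (N : E → ℝ) (K : Set E) (η : ℝ)
    (f : E → ℝ) : Prop :=
  ConvexOn ℝ K f ∧
    ∀ y ∈ K, (subdifferential K f y).Nonempty ∧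
      ∀ g ∈ subdifferential K f y, ∀ x ∈ K, f x - f y ≥ g (x - y) + η / 2 * N (x - y) ^ 2

end SpectralReg

end

noncomputable section

namespace SpectralReg

open scoped RealInnerProductSpace

/-! Let `X`, `Z` in the ball have singular values `a`, `b`, and take `α = 1`. The functional `∑ j,
log (b j / β + 1) u' j ⊗ v' j` serves as subgradient at `Z`. With overlaps `p = ⟪u i, u' j⟫`, `q =
⟪v i, v' j⟫`, the Bregman divergence is a sum over pairs of `((p + q) / 2)²` times the scalar
divergence of `(a i, b j)` plus `((p - q) / 2)²` times that of `(a i, -b j)`, as for the symmetric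
dilation, whose nonzero eigenvalues are plus and minus the nonzero singular values. The scalar
divergences are at least `(a ∓ b)² / (2ω)` once `ω > 0` bounds `a + β` and `b + β`. Young's
inequality makes this linear minus quadratic in a multiplier `l`. Test against the contraction `W`
that attains `N = ‖X - Z‖₁`: the linear terms sum to `l N`, the quadratic ones to at most `l² / 2`
times a total weight `≤ 2R`, where `R = D + min m n * β` (`IsSVD.bregman`). Choosing `l` gives `N² /
(4R)`. `StronglyConvexWrt.of_forall_exists` passes from this one subgradient to all. -/

/-! ### Scalar inequalities for the entropy. -/

/-- The scalar summand of `psi` on nonnegative arguments. -/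
def entropy (β a : ℝ) : ℝ := (a + β) * Real.log (a / β + 1) - a

theorem entropy_zero (β : ℝ) : entropy β 0 = 0 := by simp [entropy]

/-- Two terms of the series of `-log (1 - x)` at `x = 1 - r`, all of whose terms are nonnegative. -/
theorem sub_one_sub_log_bound_of_le_one {r : ℝ} (hr : 0 < r) (hr1 : r ≤ 1) :
    (1 - r) + (1 - r) ^ 2 / 2 ≤ -Real.log r := by
  have h := Real.hasSum_pow_div_log_of_abs_lt_one (x := 1 - r) (by rw [abs_lt]; constructor <;> linarith)
  have := sum_le_hasSum (Finset.range 2) (fun i _ => by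
    have : 0 ≤ 1 - r := by linarith
    positivity) h
  norm_num [Finset.sum_range_succ] at this
  linarith

theorem log_le_half_sub_inv {s : ℝ} (hs : 1 ≤ s) : Real.log s ≤ (s - s⁻¹) / 2 := by
  have h := Real.self_le_sinh_iff.2 (Real.log_nonneg hs)
  rwa [Real.sinh_log (by linarith)] at h

theorem sq_sub_le_mul_relEntropy {A B ω : ℝ} (hA : 0 < A) (hB : 0 < B) (hAω : A ≤ ω)
    (hBω : B ≤ ω) : (A - B) ^ 2 ≤ 2 * ω * (A * (Real.log A - Real.log B) - A + B) := by
  have key : (A - B) ^ 2 ≤ 2 * max A B * (A * (Real.log A - Real.log B) - A + B) := by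
    rcases le_total B A with h | h
    · rw [max_eq_left h]
      have := sub_one_sub_log_bound_of_le_one (div_pos hB hA) ((div_le_one hA).2 h)
      rw [Real.log_div hB.ne' hA.ne'] at this
      have h2 := mul_le_mul_of_nonneg_left this (by positivity : 0 ≤ 2 * A * A)
      have e : 2 * A * A * ((1 - B / A) + (1 - B / A) ^ 2 / 2) = 2 * A * (A - B) + (A - B) ^ 2 := by
        field_simp
      rw [e] at h2
      linarith
    · rw [max_eq_right h]
      have := log_le_half_sub_inv ((one_le_div hA).2 h)
      rw [Real.log_div hB.ne' hA.ne'] at this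
      have h2 := mul_le_mul_of_nonneg_left this (by positivity : 0 ≤ 2 * B * A)
      have e : 2 * B * A * ((B / A - (B / A)⁻¹) / 2) = B ^ 2 - A ^ 2 := by
        field_simp
      rw [e] at h2
      linarith
  -- Nonnegativity of this factor allows `max A B` to be enlarged to `ω`.
  have hpos : 0 ≤ A * (Real.log A - Real.log B) - A + B := by
    have : 0 < 2 * max A B := by positivity
    by_contra! hn
    nlinarith [sq_nonneg (A - B)]
  exact key.trans (by gcongr; exact max_le hAω hBω)

theorem log_div_add_one {β a : ℝ} (hβ : 0 < β) (ha : 0 ≤ a) :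
    Real.log (a / β + 1) = Real.log (a + β) - Real.log β := by
  rw [← Real.log_div (by positivity) hβ.ne']
  congr 1
  field_simp

/-- The Bregman divergence of the entropy between points of equal sign. -/
theorem sq_sub_le_mul_bregman {β a b ω : ℝ} (hβ : 0 < β) (ha : 0 ≤ a) (hb : 0 ≤ b)
    (haω : a + β ≤ ω) (hbω : b + β ≤ ω) :
    (a - b) ^ 2 ≤ 2 * ω * (entropy β a - entropy β b - Real.log (b / β + 1) * (a - b)) := by
  have := sq_sub_le_mul_relEntropy (by positivity : 0 < a + β) (by positivity : 0 < b + β) haω hbω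
  rw [entropy, entropy, log_div_add_one hβ ha, log_div_add_one hβ hb]
  calc _ = (a + β - (b + β)) ^ 2 := by ring
    _ ≤ _ := this
    _ = _ := by ring

/-- The Bregman divergence of the (even) entropy between points of opposite signs. -/
theorem sq_add_le_mul_bregman {β a b ω : ℝ} (hβ : 0 < β) (ha : 0 ≤ a) (hb : 0 ≤ b)
    (haω : a + β ≤ ω) (hbω : b + β ≤ ω) :
    (a + b) ^ 2 ≤ 2 * ω * (entropy β a - entropy β b + Real.log (b / β + 1) * (a + b)) := by
  -- Split at `0`: the pairs `(a, 0)` and `(0, b)` account for `a²` and `b²`, and `h3` for the cross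
  -- term `2ab`.
  have h1 := sq_sub_le_mul_bregman hβ ha le_rfl haω (by linarith : 0 + β ≤ ω)
  have h2 := sq_sub_le_mul_bregman hβ le_rfl hb (by linarith : 0 + β ≤ ω) hbω
  have h3 : b ≤ ω * Real.log (b / β + 1) := by
    have hl := Real.one_sub_inv_le_log_of_pos (by positivity : 0 < b / β + 1)
    have e : 1 - (b / β + 1)⁻¹ = b / (b + β) := by
      field_simp
      ring
    rw [e] at hl
    calc b = (b + β) * (b / (b + β)) := by field_simp
      _ ≤ ω * Real.log (b / β + 1) := mul_le_mul hbω hl (by positivity) (by linarith)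
  have h4 := mul_le_mul_of_nonneg_left h3 ha
  simp only [entropy_zero, zero_div, zero_add, Real.log_one] at h1 h2
  nlinarith

/-- Young's inequality: `y` is a free dual variable, so that the bound becomes linear in `e` and can
be summed over pairs. -/
theorem mul_sub_le_mul_sq {d e ω : ℝ} (hω : 0 ≤ ω) (hd : 0 ≤ d) (h : e ^ 2 ≤ 2 * ω * d)
    (x y : ℝ) : e * x * y - ω * y ^ 2 / 2 ≤ x ^ 2 * d := by
  rcases hω.eq_or_lt with rfl | hω
  · have : e = 0 := by nlinarith [sq_nonneg e]
    subst this
    have := mul_nonneg (sq_nonneg x) hd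
    linarith
  · have h1 := mul_le_mul_of_nonneg_left h (sq_nonneg x)
    have h2 := sq_nonneg (e * x - ω * y)
    by_contra! hn
    have := mul_lt_mul_of_pos_left hn (by positivity : 0 < 2 * ω)
    nlinarith

/-! ### Parseval families and the Bregman bound for operators. -/

section Families

variable {ι E F : Type*} [Fintype ι] [NormedAddCommGroup E] [InnerProductSpace ℝ E]
  [NormedAddCommGroup F] [InnerProductSpace ℝ F]

/-- A finite Parseval frame. -/
def IsParseval (u : ι → E) : Prop := ∀ x, ∑ i, ⟪u i, x⟫ • u i = x

theorem IsParseval.sum_inner_mul_inner {u : ι → E} (hu : IsParseval u) (x y : E) :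
    ∑ i, ⟪x, u i⟫ * ⟪y, u i⟫ = ⟪x, y⟫ := by
  conv_rhs => rw [← hu x, sum_inner]
  refine Finset.sum_congr rfl fun i _ => ?_
  rw [real_inner_smul_left, real_inner_comm, real_inner_comm y]

theorem IsParseval.sum_inner_sq {u : ι → E} (hu : IsParseval u) (x : E) :
    ∑ i, ⟪x, u i⟫ ^ 2 = ‖x‖ ^ 2 := by
  simpa [pow_two, real_inner_self_eq_norm_sq] using hu.sum_inner_mul_inner x x

/-- The operator `∑ k, u k ⊗ v k` attached to two families of vectors. -/
def partialIsometry (u : ι → E) (v : ι → F) (x : F) : E := ∑ k, ⟪v k, x⟫ • u k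

theorem inner_partialIsometry (u : ι → E) (v : ι → F) (x : F) (y : E) :
    ⟪y, partialIsometry u v x⟫ = ∑ k, ⟪y, u k⟫ * ⟪x, v k⟫ := by
  simp only [partialIsometry, inner_sum, real_inner_smul_right]
  refine Finset.sum_congr rfl fun k _ => ?_
  rw [real_inner_comm x, mul_comm]

theorem inner_partialIsometry_symm (u : ι → E) (v : ι → F) (x : F) (y : E) :
    ⟪y, partialIsometry u v x⟫ = ⟪x, partialIsometry v u y⟫ := by
  simp only [inner_partialIsometry, mul_comm]

theorem norm_partialIsometry_sq_le {u : ι → E} {v : ι → F} (hu : IsParseval u)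
    (hv : IsParseval v) (x : F) : ‖partialIsometry u v x‖ ^ 2 ≤ ‖x‖ ^ 2 := by
  set y := partialIsometry u v x with hy
  -- Cauchy–Schwarz with `y` the image of `x` gives `‖y‖⁴ ≤ ‖y‖² ‖x‖²`.
  have h := Finset.sum_mul_sq_le_sq_mul_sq Finset.univ (fun k => ⟪y, u k⟫) (fun k => ⟪x, v k⟫)
  rw [← inner_partialIsometry, ← hy, real_inner_self_eq_norm_sq, hu.sum_inner_sq,
    hv.sum_inner_sq] at h
  by_contra! hn
  nlinarith [sq_nonneg ‖x‖]

/-- A singular value decomposition of `T` with Parseval families as singular vectors; the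
members of the families that are indexed by `s` are unit vectors, and the singular values outside
`s` vanish. -/
structure IsSVD (T : F →ₗ[ℝ] E) (s : Finset ι) (a : ι → ℝ) (u : ι → E) (v : ι → F) : Prop where
  left : IsParseval u
  right : IsParseval v
  norm_left : ∀ i ∈ s, ‖u i‖ = 1
  norm_right : ∀ i ∈ s, ‖v i‖ = 1
  nonneg : ∀ i, 0 ≤ a i
  eq_zero : ∀ i ∉ s, a i = 0
  map : ∀ i, T (v i) = a i • u i

variable {T X Z : F →ₗ[ℝ] E} {s : Finset ι} {a b h : ι → ℝ} {u u' r : ι → E} {v v' r' : ι → F}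

theorem IsSVD.inner_map (hT : IsSVD T s a u v) (y : E) (x : F) :
    ⟪y, T x⟫ = ∑ i, a i * (⟪y, u i⟫ * ⟪x, v i⟫) := by
  conv_lhs => rw [← hT.right x]
  simp only [map_sum, map_smul, hT.map, inner_sum, real_inner_smul_right]
  refine Finset.sum_congr rfl fun i _ => ?_
  rw [real_inner_comm x]
  ring

/-- Vectors outside `s` need not be unit, but there `g (a i) = 0`. -/
theorem IsSVD.mul_norm_left_sq (hT : IsSVD T s a u v) {g : ℝ → ℝ} (hg : g 0 = 0) (i : ι) :
    ‖u i‖ ^ 2 * g (a i) = g (a i) := by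
  by_cases hi : i ∈ s
  · simp [hT.norm_left i hi]
  · simp [hT.eq_zero i hi, hg]

theorem IsSVD.mul_norm_right_sq (hT : IsSVD T s a u v) {g : ℝ → ℝ} (hg : g 0 = 0) (i : ι) :
    ‖v i‖ ^ 2 * g (a i) = g (a i) := by
  by_cases hi : i ∈ s
  · simp [hT.norm_right i hi]
  · simp [hT.eq_zero i hi, hg]

theorem IsSVD.inner_map_self (hT : IsSVD T s a u v) (i : ι) : ⟪u i, T (v i)⟫ = a i := by
  rw [hT.map, real_inner_smul_right, real_inner_self_eq_norm_sq, mul_comm]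
  exact hT.mul_norm_left_sq (g := id) rfl i

theorem IsSVD.sum_inner_map (hT : IsSVD T s a u v) (r : ι → E) (r' : ι → F) :
    ∑ k, ⟪r k, T (r' k)⟫ = ∑ i, a i * ⟪u i, partialIsometry r r' (v i)⟫ := by
  simp only [hT.inner_map, inner_partialIsometry, Finset.mul_sum]
  rw [Finset.sum_comm]
  refine Finset.sum_congr rfl fun i _ => Finset.sum_congr rfl fun k _ => ?_
  rw [real_inner_comm (u i), real_inner_comm (v i)]

/-- Von Neumann's trace inequality against a partial isometry. -/
theorem IsSVD.sum_inner_map_le (hT : IsSVD T s a u v) (hr : IsParseval r) (hr' : IsParseval r') :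
    ∑ k, ⟪r k, T (r' k)⟫ ≤ ∑ i, a i := by
  rw [hT.sum_inner_map]
  refine Finset.sum_le_sum fun i _ => ?_
  by_cases hi : i ∈ s
  · refine mul_le_of_le_one_right (hT.nonneg i) ?_
    have h1 := norm_partialIsometry_sq_le hr hr' (v i)
    rw [hT.norm_right i hi] at h1
    have h2 : ‖partialIsometry r r' (v i)‖ ≤ 1 := by
      by_contra! hn
      nlinarith
    calc _ ≤ ‖u i‖ * ‖partialIsometry r r' (v i)‖ := real_inner_le_norm _ _
      _ ≤ 1 := by rw [hT.norm_left i hi, one_mul]; exact h2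
  · simp [hT.eq_zero i hi]


open Classical in
/-- The weights `a i + β` of the indices in `s`, extended by zero. -/
def weight (s : Finset ι) (β : ℝ) (a : ι → ℝ) (i : ι) : ℝ := if i ∈ s then a i + β else 0

theorem sum_weight (s : Finset ι) (β : ℝ) (ha : ∀ i ∉ s, a i = 0) :
    ∑ i, weight s β a i = ∑ i, a i + s.card * β := by
  classical
  have : ∀ i, weight s β a i = a i + if i ∈ s then β else 0 := fun i => by
    by_cases hi : i ∈ s
    · simp [weight, hi]
    · simp [weight, hi, ha i hi]
  simp [this, Finset.sum_add_distrib]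

theorem IsSVD.weight_nonneg {β : ℝ} (hT : IsSVD T s a u v) (hβ : 0 < β) (i : ι) :
    0 ≤ weight s β a i := by
  have := hT.nonneg i
  unfold weight
  split_ifs <;> linarith

/-- Indices outside `s` carry no `β`, so the total weight sees only `s.card`. A sum of two weights
still serves as `ω`, unless both indices lie outside `s`, where the pair contributes nothing. -/
theorem IsSVD.weight_bounds {β : ℝ} (hX : IsSVD X s a u v) (hZ : IsSVD Z s b u' v') (hβ : 0 < β)
    (i j : ι) : (a i = 0 ∧ b j = 0 ∧ weight s β a i + weight s β b j = 0) ∨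
      (a i + β ≤ weight s β a i + weight s β b j ∧ b j + β ≤ weight s β a i + weight s β b j) := by
  have ha := hX.nonneg i
  have hb := hZ.nonneg j
  by_cases hi : i ∈ s <;> by_cases hj : j ∈ s
  · right
    simp only [weight, hi, hj, if_true]
    constructor <;> linarith
  · right
    simp [weight, hi, hj, hZ.eq_zero j hj, ha]
  · right
    simp [weight, hi, hj, hX.eq_zero i hi, hb]
  · left
    simp [weight, hi, hj, hX.eq_zero i hi, hZ.eq_zero j hj]

/-- The contribution of a pair of singular vectors to the Bregman divergence. -/
theorem IsSVD.bregman_term {β : ℝ} (hX : IsSVD X s a u v) (hZ : IsSVD Z s b u' v') (hβ : 0 < β)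
    (i j : ι) (p q S T l : ℝ) :
    l / 2 * (a i * (p * S + q * T) - b j * (p * T + q * S)) -
        l ^ 2 * (S ^ 2 + T ^ 2) / 4 * (weight s β a i + weight s β b j) ≤
      (p ^ 2 + q ^ 2) / 2 * (entropy β (a i) - entropy β (b j) + Real.log (b j / β + 1) * b j) -
        Real.log (b j / β + 1) * (a i * (p * q)) := by
  rcases hX.weight_bounds hZ hβ i j with ⟨h1, h2, h3⟩ | ⟨h1, h2⟩
  · simp [h1, h2, h3, entropy_zero]
  set ω := weight s β a i + weight s β b j
  have ha := hX.nonneg i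
  have hb := hZ.nonneg j
  have hω : 0 < ω := by linarith
  have b1 := sq_sub_le_mul_bregman hβ ha hb h1 h2
  have b2 := sq_add_le_mul_bregman hβ ha hb h1 h2
  have d1 := nonneg_of_mul_nonneg_right ((sq_nonneg _).trans b1) (by positivity)
  have d2 := nonneg_of_mul_nonneg_right ((sq_nonneg _).trans b2) (by positivity)
  have c1 := mul_sub_le_mul_sq hω.le d1 b1 ((p + q) / 2) (l * (S + T) / 2)
  have c2 := mul_sub_le_mul_sq hω.le d2 b2 ((p - q) / 2) (l * (S - T) / 2)
  calc _ = (a i - b j) * ((p + q) / 2) * (l * (S + T) / 2) - ω * (l * (S + T) / 2) ^ 2 / 2 +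
      ((a i + b j) * ((p - q) / 2) * (l * (S - T) / 2) - ω * (l * (S - T) / 2) ^ 2 / 2) := by ring
    _ ≤ _ := add_le_add c1 c2
    _ = _ := by ring

/-- By Parseval, the rows and columns of squared entries sum to `‖W (v i)‖²` and `‖W* (u' j)‖²`, at
most `1` wherever the weight is nonzero. -/
theorem IsSVD.sum_inner_sq_mul_weight_le {β : ℝ} (hX : IsSVD X s a u v) (hZ : IsSVD Z s b u' v')
    (hr : IsParseval r) (hr' : IsParseval r') (hβ : 0 < β) :
    ∑ i, ∑ j, ⟪u' j, partialIsometry r r' (v i)⟫ ^ 2 * (weight s β a i + weight s β b j) ≤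
      ∑ i, weight s β a i + ∑ j, weight s β b j := by
  simp only [mul_add, Finset.sum_add_distrib]
  have bound : ∀ (t w : ℝ) (i : ι), 0 ≤ w → (i ∈ s → t ≤ 1) → (i ∉ s → w = 0) → t * w ≤ w := by
    intro t w i hw h1 h2
    by_cases hi : i ∈ s
    · exact mul_le_of_le_one_left hw (h1 hi)
    · simp [h2 hi]
  refine add_le_add ?_ ?_
  · refine Finset.sum_le_sum fun i _ => ?_
    rw [← Finset.sum_mul]
    refine bound _ _ i (hX.weight_nonneg hβ i) (fun hi => ?_) (fun hi => by simp [weight, hi])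
    simp only [real_inner_comm _ (u' _)]
    rw [hZ.left.sum_inner_sq]
    simpa [hX.norm_right i hi] using norm_partialIsometry_sq_le hr hr' (v i)
  · rw [Finset.sum_comm]
    refine Finset.sum_le_sum fun j _ => ?_
    rw [← Finset.sum_mul]
    refine bound _ _ j (hZ.weight_nonneg hβ j) (fun hj => ?_) (fun hj => by simp [weight, hj])
    simp only [inner_partialIsometry_symm r r', real_inner_comm _ (v _)]
    rw [hX.right.sum_inner_sq]
    simpa [hZ.norm_left j hj] using norm_partialIsometry_sq_le hr' hr (u' j)

/-- A lower bound on the Bregman divergence of the spectral entropy, by a linear minus a quadratic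
function of the nuclear norm of the difference. -/
theorem IsSVD.bregman {β : ℝ} (hX : IsSVD X s a u v) (hZ : IsSVD Z s b u' v')
    (hr : IsParseval r) (hr' : IsParseval r') (hβ : 0 < β) (l : ℝ) :
    l * (∑ k, ⟪r k, (X - Z) (r' k)⟫) -
        l ^ 2 / 2 * (∑ i, weight s β a i + ∑ j, weight s β b j) ≤
      ∑ i, entropy β (a i) - ∑ j, entropy β (b j) -
        ∑ j, Real.log (b j / β + 1) * ⟪u' j, (X - Z) (v' j)⟫ := by
  set p : ι → ι → ℝ := fun i j => ⟪u i, u' j⟫ with hp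
  set q : ι → ι → ℝ := fun i j => ⟪v i, v' j⟫ with hq
  set S : ι → ι → ℝ := fun i j => ⟪u' j, partialIsometry r r' (v i)⟫ with hS
  set T : ι → ι → ℝ := fun i j => ⟪u i, partialIsometry r r' (v' j)⟫ with hT
  have main := Finset.sum_le_sum fun i (_ : i ∈ Finset.univ) =>
    Finset.sum_le_sum fun j (_ : j ∈ Finset.univ) =>
      hX.bregman_term hZ hβ i j (p i j) (q i j) (S i j) (T i j) l
  have hp1 : ∀ i, ∑ j, p i j ^ 2 = ‖u i‖ ^ 2 := fun i => hZ.left.sum_inner_sq _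
  have hq1 : ∀ i, ∑ j, q i j ^ 2 = ‖v i‖ ^ 2 := fun i => hZ.right.sum_inner_sq _
  have hp2 : ∀ j, ∑ i, p i j ^ 2 = ‖u' j‖ ^ 2 := fun j => by
    simp only [hp, real_inner_comm (u' j)]
    exact hX.left.sum_inner_sq _
  have hq2 : ∀ j, ∑ i, q i j ^ 2 = ‖v' j‖ ^ 2 := fun j => by
    simp only [hq, real_inner_comm (v' j)]
    exact hX.right.sum_inner_sq _
  have hpS : ∀ i, ∑ j, p i j * S i j = ⟪u i, partialIsometry r r' (v i)⟫ := fun i => by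
    simp only [hp, hS, real_inner_comm _ (u' _)]
    simpa only [real_inner_comm] using hZ.left.sum_inner_mul_inner (u i) (partialIsometry r r' (v i))
  have hqT : ∀ i, ∑ j, q i j * T i j = ⟪u i, partialIsometry r r' (v i)⟫ := fun i => by
    simp only [hq, hT, inner_partialIsometry_symm r r']
    rw [← hZ.right.sum_inner_mul_inner]
    simp only [real_inner_comm (v' _)]
  have hpT : ∀ j, ∑ i, p i j * T i j = ⟪u' j, partialIsometry r r' (v' j)⟫ := fun j => by
    rw [← hX.left.sum_inner_mul_inner]
    simp only [hp, hT, real_inner_comm (u _)]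
  have hqS : ∀ j, ∑ i, q i j * S i j = ⟪u' j, partialIsometry r r' (v' j)⟫ := fun j => by
    simp only [hq, hS, inner_partialIsometry_symm r r']
    rw [← hX.right.sum_inner_mul_inner]
    simp only [real_inner_comm (v _)]
  have e1 : ∑ i, ∑ j, l / 2 * (a i * (p i j * S i j + q i j * T i j) -
      b j * (p i j * T i j + q i j * S i j)) = l * ∑ k, ⟪r k, (X - Z) (r' k)⟫ := by
    simp only [LinearMap.sub_apply, inner_sub_right, Finset.sum_sub_distrib, hX.sum_inner_map,
      hZ.sum_inner_map, mul_sub, ← Finset.mul_sum]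
    congr 1
    · simp only [mul_add, Finset.sum_add_distrib, hpS, hqT]
      ring
    · rw [Finset.sum_comm]
      simp only [mul_add, Finset.sum_add_distrib, ← Finset.mul_sum, hpT, hqS]
      ring
  have e2 : ∑ i, ∑ j, l ^ 2 * (S i j ^ 2 + T i j ^ 2) / 4 * (weight s β a i + weight s β b j) ≤
      l ^ 2 / 2 * (∑ i, weight s β a i + ∑ j, weight s β b j) := by
    have t1 := hX.sum_inner_sq_mul_weight_le hZ hr hr' hβ
    have t2 : ∑ i, ∑ j, T i j ^ 2 * (weight s β a i + weight s β b j) ≤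
        ∑ i, weight s β a i + ∑ j, weight s β b j := by
      -- `T` is `S` with `X` and `Z` exchanged.
      rw [Finset.sum_comm, add_comm (∑ i, weight s β a i)]
      simpa only [add_comm (weight s β a _)] using hZ.sum_inner_sq_mul_weight_le hX hr hr' hβ
    have t3 := mul_le_mul_of_nonneg_left (add_le_add t1 t2) (by positivity : 0 ≤ l ^ 2 / 4)
    simp only [← Finset.sum_add_distrib, Finset.mul_sum] at t3
    calc _ = _ := Finset.sum_congr rfl fun i _ => Finset.sum_congr rfl fun j _ => by ring
      _ ≤ _ := t3
      _ = _ := by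
        simp only [Finset.sum_add_distrib, ← Finset.mul_sum]
        ring
  have e3 : ∑ i, ∑ j, ((p i j ^ 2 + q i j ^ 2) / 2 *
      (entropy β (a i) - entropy β (b j) + Real.log (b j / β + 1) * b j) -
        Real.log (b j / β + 1) * (a i * (p i j * q i j))) =
      ∑ i, entropy β (a i) - ∑ j, entropy β (b j) -
        ∑ j, Real.log (b j / β + 1) * ⟪u' j, (X - Z) (v' j)⟫ := by
    have f1 : ∑ i, ∑ j, (p i j ^ 2 + q i j ^ 2) / 2 * entropy β (a i) = ∑ i, entropy β (a i) := by
      refine Finset.sum_congr rfl fun i _ => ?_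
      rw [← Finset.sum_mul, ← Finset.sum_div, Finset.sum_add_distrib, hp1, hq1]
      linarith [hX.mul_norm_left_sq (entropy_zero β) i, hX.mul_norm_right_sq (entropy_zero β) i]
    have f2 (g : ℝ → ℝ) (hg : g 0 = 0) :
        ∑ i, ∑ j, (p i j ^ 2 + q i j ^ 2) / 2 * g (b j) = ∑ j, g (b j) := by
      rw [Finset.sum_comm]
      refine Finset.sum_congr rfl fun j _ => ?_
      rw [← Finset.sum_mul, ← Finset.sum_div, Finset.sum_add_distrib, hp2, hq2]
      linarith [hZ.mul_norm_left_sq hg j, hZ.mul_norm_right_sq hg j]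
    have f3 : ∑ i, ∑ j, Real.log (b j / β + 1) * (a i * (p i j * q i j)) =
        ∑ j, Real.log (b j / β + 1) * ⟪u' j, X (v' j)⟫ := by
      rw [Finset.sum_comm]
      refine Finset.sum_congr rfl fun j _ => ?_
      rw [← Finset.mul_sum, hX.inner_map]
      simp only [hp, hq, real_inner_comm]
    have f4 := f2 (entropy β) (entropy_zero β)
    have f5 := f2 (fun x => Real.log (x / β + 1) * x) (by simp)
    simp only [mul_add, mul_sub, Finset.sum_add_distrib, Finset.sum_sub_distrib,
      LinearMap.sub_apply, inner_sub_right, hZ.inner_map_self, f1, f3, f4, f5]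
    ring
  simp only [Finset.sum_sub_distrib] at main e1 e3
  rw [e1, e3] at main
  linarith

end Families


/-! ### Singular value decomposition on a common index set. -/

section Padding

/-- The extension by zero of a family indexed by `Fin m`. -/
def padZero {M : Type*} [Zero M] {m : ℕ} (c : Fin m → M) (i : ℕ) : M :=
  if h : i < m then c ⟨i, h⟩ else 0

@[simp]
theorem padZero_val {M : Type*} [Zero M] {m : ℕ} (c : Fin m → M) (i : Fin m) : padZero c i = c i := by
  simp [padZero]

theorem padZero_of_lt {M : Type*} [Zero M] {m : ℕ} (c : Fin m → M) {i : ℕ} (h : i < m) :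
    padZero c i = c ⟨i, h⟩ :=
  dif_pos h

theorem padZero_of_le {M : Type*} [Zero M] {m : ℕ} (c : Fin m → M) {i : ℕ} (h : m ≤ i) :
    padZero c i = 0 :=
  dif_neg (by omega)

theorem sum_fin_eq_of_le {M : Type*} [AddCommMonoid M] {d N : ℕ} (hdN : d ≤ N) {f : ℕ → M}
    (hf : ∀ i, d ≤ i → f i = 0) : ∑ i : Fin N, f i = ∑ i : Fin d, f i := by
  rw [Fin.sum_univ_eq_sum_range, Fin.sum_univ_eq_sum_range]
  refine (Finset.sum_subset (Finset.range_subset_range.2 hdN) fun i _ hi => hf i ?_).symm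
  simpa using hi

variable {E F : Type*} [NormedAddCommGroup E] [InnerProductSpace ℝ E]
  [NormedAddCommGroup F] [InnerProductSpace ℝ F]

/-- Zero vectors preserve the Parseval identity, so bases of spaces of different dimensions can
share one index set. -/
theorem isParseval_padZero {m N : ℕ} (c : OrthonormalBasis (Fin m) ℝ E) (hN : m ≤ N) :
    IsParseval fun i : Fin N => padZero c i := by
  intro x
  rw [sum_fin_eq_of_le (f := fun i => ⟪padZero c i, x⟫ • padZero c i) hN
    fun i hi => by simp [padZero_of_le _ hi]]
  simpa using c.sum_repr' x

variable [FiniteDimensional ℝ E] [FiniteDimensional ℝ F] {m n : ℕ}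

theorem singularValues_eq_zero_of_min_le (hm : Module.finrank ℝ E = m)
    (hn : Module.finrank ℝ F = n) (T : F →ₗ[ℝ] E) {i : ℕ} (hi : min m n ≤ i) :
    T.singularValues i = 0 := by
  rw [LinearMap.singularValues_eq_zero_iff_le_finrank_range]
  have h1 := T.range.finrank_le
  have h2 := T.finrank_range_le
  omega

/-- Existence of the singular value decomposition. -/
theorem exists_isSVD (hm : Module.finrank ℝ E = m) (hn : Module.finrank ℝ F = n)
    (T : F →ₗ[ℝ] E) : ∃ (u : Fin (max m n) → E) (v : Fin (max m n) → F),
      IsSVD T (Finset.univ.filter fun i : Fin (max m n) => (i : ℕ) < min m n)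
        (fun i => T.singularValues i) u v := by
  set b := T.isSymmetric_adjoint_comp_self.eigenvectorBasis hn
  have hT : ∀ i j, ⟪T (b i), T (b j)⟫ = if i = j then T.singularValues j ^ 2 else 0 := fun i j => by
    rw [← LinearMap.adjoint_inner_right, ← LinearMap.comp_apply,
      T.isSymmetric_adjoint_comp_self.apply_eigenvectorBasis hn, real_inner_smul_right,
      b.inner_eq_ite, T.sq_singularValues_fin hn]
    simp
  -- Normalised images of eigenvectors of `T* T` with nonzero singular value; they extend to an
  -- orthonormal basis of the target.
  have horth : Orthonormal ℝ (Set.domRestrict {i : Fin m | T.singularValues i ≠ 0}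
      fun i => (T.singularValues i)⁻¹ • T (padZero b i)) := by
    have hlt : ∀ i : Fin m, T.singularValues i ≠ 0 → (i : ℕ) < n := fun i hi => by
      by_contra! h
      exact hi (T.singularValues_of_finrank_le (hn.trans_le h))
    rw [orthonormal_iff_ite]
    rintro ⟨i, hi⟩ ⟨j, hj⟩
    simp only [Set.mem_ofPred_eq] at hi hj
    simp only [Set.domRestrict_apply, real_inner_smul_left, real_inner_smul_right,
      padZero_of_lt b (hlt i hi), padZero_of_lt b (hlt j hj), hT, Subtype.mk.injEq,
      Fin.ext_iff]
    split_ifs with h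
    · rw [h]
      field_simp
    · simp
  obtain ⟨c, hc⟩ := horth.exists_orthonormalBasis_extension_of_card_eq (by simpa using hm)
  refine ⟨fun i => padZero c i, fun i => padZero b i, isParseval_padZero c (le_max_left _ _),
    isParseval_padZero b (le_max_right _ _), fun i hi => ?_, fun i hi => ?_,
    fun i => T.singularValues_nonneg i, fun i hi => ?_, fun i => ?_⟩
  · simp only [Finset.mem_filter, Finset.mem_univ, true_and, lt_min_iff] at hi
    simp [padZero_of_lt c hi.1]
  · simp only [Finset.mem_filter, Finset.mem_univ, true_and, lt_min_iff] at hi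
    simp [padZero_of_lt b hi.2]
  · exact singularValues_eq_zero_of_min_le hm hn T (by simpa only [Finset.mem_filter_univ, not_lt] using hi)
  · by_cases h0 : T.singularValues i = 0
    · simp only [h0, zero_smul]
      rcases lt_or_ge (i : ℕ) n with h | h
      · rw [padZero_of_lt b h, ← inner_self_eq_zero (𝕜 := ℝ), hT]
        simp [h0]
      · simp [padZero_of_le _ h]
    · have hi : (i : ℕ) < m := by
        by_contra! h
        exact h0 (singularValues_eq_zero_of_min_le hm hn T ((min_le_left _ _).trans h))
      have := hc ⟨i, hi⟩ h0
      simp only [padZero_of_lt c hi, this, smul_smul]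
      rw [mul_inv_cancel₀ h0, one_smul]

end Padding

/-! ### From one strong subgradient to all subgradients. -/

section Segment

open Filter Topology

variable {E : Type*} [AddCommGroup E] [Module ℝ E]

/-- Strong convexity follows from a quadratically improved subgradient inequality for one
subgradient at every point. -/
theorem StronglyConvexWrt.of_forall_exists {N : E → ℝ} {K : Set E} {η : ℝ} {f : E → ℝ}
    (hK : Convex ℝ K) (hη : 0 ≤ η)
    (hN : ∀ (c : ℝ) (x : E), 0 < c → N (c • x) = c * N x)
    (h : ∀ y ∈ K, ∃ g : Module.Dual ℝ E, ∀ x ∈ K, g (x - y) + η / 2 * N (x - y) ^ 2 ≤ f x - f y) :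
    StronglyConvexWrt N K η f := by
  have h' : ∀ y ∈ K, ∃ g : Module.Dual ℝ E, (∀ x ∈ K, g (x - y) ≤ f x - f y) ∧
      ∀ x ∈ K, g (x - y) + η / 2 * N (x - y) ^ 2 ≤ f x - f y := fun y hy => by
    obtain ⟨g, hg⟩ := h y hy
    refine ⟨g, fun x hx => ?_, hg⟩
    have := hg x hx
    have : 0 ≤ η / 2 * N (x - y) ^ 2 := by positivity
    linarith
  refine ⟨⟨hK, fun x hx y hy a b ha hb hab => ?_⟩, fun y hy => ⟨?_, fun g hg x hx => ?_⟩⟩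
  · obtain ⟨g, hg, -⟩ := h' _ (hK hx hy ha hb hab)
    set z := a • x + b • y with hz
    have h1 := mul_le_mul_of_nonneg_left (hg x hx) ha
    have h2 := mul_le_mul_of_nonneg_left (hg y hy) hb
    have h3 : a * g (x - z) + b * g (y - z) = 0 := by
      rw [← smul_eq_mul, ← smul_eq_mul, ← map_smul, ← map_smul, ← map_add]
      have : a • (x - z) + b • (y - z) = z - (a + b) • z := by rw [hz]; module
      rw [this, hab, one_smul, sub_self, map_zero]
    have h4 : a * f z + b * f z = f z := by rw [← add_mul, hab, one_mul]
    simp only [smul_eq_mul]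
    linarith
  · obtain ⟨g, hg, -⟩ := h' y hy
    exact ⟨g, hg⟩
  -- At `z = (1 - t) y + t x`, combine the strong inequality towards `x` with the plain one towards
  -- `y`, weights `t` and `1 - t`: the functional `G` at `z` cancels. Add the inequality for `g` at
  -- `z`, divide by `t`, let `t → 0`.
  · have key : ∀ t ∈ Set.Ioo (0 : ℝ) 1,
        g (x - y) + η / 2 * ((1 - t) * N (x - y)) ^ 2 ≤ f x - f y := by
      rintro t ⟨ht0, ht1⟩
      have hz : (1 - t) • y + t • x ∈ K := hK hy hx (by linarith) ht0.le (by ring)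
      obtain ⟨G, hG, hG'⟩ := h' _ hz
      have h0 := hg _ hz
      have h1 := mul_le_mul_of_nonneg_left (hG' x hx) ht0.le
      have h2 := mul_le_mul_of_nonneg_left (hG y hy) (by linarith : 0 ≤ 1 - t)
      have e0 : (1 - t) • y + t • x - y = t • (x - y) := by module
      have e1 : x - ((1 - t) • y + t • x) = (1 - t) • (x - y) := by module
      have e2 : y - ((1 - t) • y + t • x) = (-t) • (x - y) := by module
      rw [e0, map_smul, smul_eq_mul] at h0
      rw [e1, map_smul, smul_eq_mul, hN _ _ (by linarith)] at h1
      rw [e2, map_smul, smul_eq_mul] at h2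
      refine le_of_mul_le_mul_left ?_ ht0
      linarith
    have hlim : Tendsto (fun t : ℝ => g (x - y) + η / 2 * ((1 - t) * N (x - y)) ^ 2) (𝓝[>] 0)
        (𝓝 (g (x - y) + η / 2 * ((1 - 0) * N (x - y)) ^ 2)) :=
      (Continuous.tendsto (by fun_prop) 0).mono_left nhdsWithin_le_nhds
    rw [sub_zero, one_mul] at hlim
    refine le_of_tendsto hlim ?_
    filter_upwards [Ioo_mem_nhdsGT one_pos] with t ht using key t ht

end Segment

/-! ### Nuclear norm and conclusion for matrices. -/

section Matrix

variable {m n : ℕ}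

theorem exists_isSVD_matrix (X : Matrix (Fin m) (Fin n) ℝ) :
    ∃ (u : Fin (max m n) → EuclideanSpace ℝ (Fin m)) (v : Fin (max m n) → EuclideanSpace ℝ (Fin n)),
      IsSVD (Matrix.toEuclideanLin X)
        (Finset.univ.filter fun i : Fin (max m n) => (i : ℕ) < min m n)
        (fun i => (Matrix.toEuclideanLin X).singularValues i) u v :=
  exists_isSVD (by simp) (by simp) _

theorem sum_sigma (X : Matrix (Fin m) (Fin n) ℝ) {g : ℝ → ℝ} (hg : g 0 = 0) :
    ∑ i : Fin (max m n), g ((Matrix.toEuclideanLin X).singularValues i) = ∑ i, g (sigma X i) :=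
  sum_fin_eq_of_le (f := fun i => g ((Matrix.toEuclideanLin X).singularValues i)) min_le_max
    fun i hi => by rw [singularValues_eq_zero_of_min_le (by simp) (by simp) _ hi, hg]

theorem sum_singularValues (X : Matrix (Fin m) (Fin n) ℝ) :
    ∑ i : Fin (max m n), (Matrix.toEuclideanLin X).singularValues i = nuclearNorm X :=
  sum_sigma X (g := id) rfl

theorem Psi_eq (α β : ℝ) (X : Matrix (Fin m) (Fin n) ℝ) : Psi α β X =
    α * ∑ i : Fin (max m n), entropy β ((Matrix.toEuclideanLin X).singularValues i) := by
  rw [sum_sigma X (entropy_zero β)]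
  simp only [Psi, psi, Function.comp_apply, entropy]
  congr 1
  refine Finset.sum_congr rfl fun i _ => ?_
  have h : 0 ≤ sigma X i := LinearMap.singularValues_nonneg _ _
  rw [abs_of_nonneg h]

/-- The nuclear norm is dual to the partial isometries. -/
theorem exists_nuclearNorm_eq (H : Matrix (Fin m) (Fin n) ℝ) :
    ∃ (r : Fin (max m n) → EuclideanSpace ℝ (Fin m))
      (r' : Fin (max m n) → EuclideanSpace ℝ (Fin n)), IsParseval r ∧ IsParseval r' ∧
      nuclearNorm H = ∑ k, ⟪r k, Matrix.toEuclideanLin H (r' k)⟫ ∧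
      ∀ X : Matrix (Fin m) (Fin n) ℝ,
        ∑ k, ⟪r k, Matrix.toEuclideanLin X (r' k)⟫ ≤ nuclearNorm X := by
  obtain ⟨r, r', h⟩ := exists_isSVD_matrix H
  refine ⟨r, r', h.left, h.right, ?_, fun X => ?_⟩
  · rw [← sum_singularValues]
    exact Finset.sum_congr rfl fun k _ => (h.inner_map_self k).symm
  · obtain ⟨u, v, hX⟩ := exists_isSVD_matrix X
    rw [← sum_singularValues]
    exact hX.sum_inner_map_le h.left h.right

/-- The nuclear norm is a maximum of linear functionals, hence sublinear. -/
theorem nuclearNorm_smul_add_smul_le (X Y : Matrix (Fin m) (Fin n) ℝ) {s t : ℝ} (hs : 0 ≤ s)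
    (ht : 0 ≤ t) : nuclearNorm (s • X + t • Y) ≤ s * nuclearNorm X + t * nuclearNorm Y := by
  obtain ⟨r, r', -, -, h, hle⟩ := exists_nuclearNorm_eq (s • X + t • Y)
  rw [h]
  simp only [map_add, map_smul, LinearMap.add_apply, LinearMap.smul_apply, inner_add_right,
    real_inner_smul_right, Finset.sum_add_distrib, ← Finset.mul_sum]
  exact add_le_add (mul_le_mul_of_nonneg_left (hle X) hs) (mul_le_mul_of_nonneg_left (hle Y) ht)

theorem nuclearNorm_smul {c : ℝ} (hc : 0 < c) (X : Matrix (Fin m) (Fin n) ℝ) :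
    nuclearNorm (c • X) = c * nuclearNorm X := by
  have le : ∀ {c : ℝ} (_ : 0 < c) (X : Matrix (Fin m) (Fin n) ℝ),
      nuclearNorm (c • X) ≤ c * nuclearNorm X := fun hc X => by
    simpa using nuclearNorm_smul_add_smul_le X X hc.le le_rfl
  refine (le hc X).antisymm ?_
  have := le (inv_pos.2 hc) (c • X)
  rw [inv_smul_smul₀ hc.ne', ← div_eq_inv_mul, le_div_iff₀ hc] at this
  linarith

theorem convex_nuclearBall (D : ℝ) : Convex ℝ (nuclearBall m n D) := by
  intro X hX Y hY s t hs ht hst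
  have h1 : nuclearNorm X ≤ D := hX
  have h2 : nuclearNorm Y ≤ D := hY
  calc _ ≤ _ := nuclearNorm_smul_add_smul_le X Y hs ht
    _ ≤ s * D + t * D := by gcongr
    _ = D := by rw [← add_mul, hst, one_mul]

theorem exists_strong_subgradient {α β D : ℝ} (hα : 0 ≤ α) (hβ : 0 < β) (hD : 0 ≤ D)
    {Z : Matrix (Fin m) (Fin n) ℝ} (hZ : Z ∈ nuclearBall m n D) :
    ∃ g : Module.Dual ℝ (Matrix (Fin m) (Fin n) ℝ), ∀ X ∈ nuclearBall m n D,
      g (X - Z) + α / (2 * (D + (min m n : ℕ) * β)) / 2 * nuclearNorm (X - Z) ^ 2 ≤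
        Psi α β X - Psi α β Z := by
  obtain ⟨u', v', hsZ⟩ := exists_isSVD_matrix Z
  set b : Fin (max m n) → ℝ := fun j => (Matrix.toEuclideanLin Z).singularValues j with hb
  let g : Module.Dual ℝ (Matrix (Fin m) (Fin n) ℝ) := IsLinearMap.mk'
    (fun H => α * ∑ j, Real.log (b j / β + 1) * ⟪u' j, Matrix.toEuclideanLin H (v' j)⟫)
    { map_add := fun H H' => by
        simp only [map_add, LinearMap.add_apply, inner_add_right, mul_add, Finset.sum_add_distrib]
      map_smul := fun c H => by
        simp only [map_smul, LinearMap.smul_apply, real_inner_smul_right, smul_eq_mul,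
          Finset.mul_sum]
        exact Finset.sum_congr rfl fun _ _ => by ring }
  refine ⟨g, fun X hX => ?_⟩
  obtain ⟨u, v, hsX⟩ := exists_isSVD_matrix X
  obtain ⟨r, r', hr, hr', hN, -⟩ := exists_nuclearNorm_eq (X - Z)
  set R := D + (min m n : ℕ) * β with hR
  have hR0 : 0 ≤ R := by positivity
  set N := nuclearNorm (X - Z)
  -- This `l` maximises `l N - l² R`. If `R = 0`, division by zero makes it `0`, matching `η = 0`.
  have key := hsX.bregman hsZ hr hr' hβ (N / (2 * R))
  rw [sum_weight _ _ hsX.eq_zero, sum_weight _ _ hsZ.eq_zero, sum_singularValues,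
    sum_singularValues, ← map_sub, ← hN] at key
  have hcard : (Finset.univ.filter fun i : Fin (max m n) => (i : ℕ) < min m n).card = min m n := by
    rw [Finset.card_filter, sum_fin_eq_of_le (f := fun i => if i < min m n then 1 else 0) min_le_max
      fun i hi => if_neg hi.not_gt]
    simp only [Fin.is_lt, if_true, Finset.sum_const, Finset.card_univ, Fintype.card_fin,
      smul_eq_mul, mul_one]
  rw [hcard] at key
  have hw : nuclearNorm X + (min m n : ℕ) * β + (nuclearNorm Z + (min m n : ℕ) * β) ≤ 2 * R := by
    have h1 : nuclearNorm X ≤ D := hX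
    have h2 : nuclearNorm Z ≤ D := hZ
    linarith
  have h1 : N ^ 2 / (2 * R) / 2 ≤ N / (2 * R) * N - (N / (2 * R)) ^ 2 / 2 *
      (nuclearNorm X + (min m n : ℕ) * β + (nuclearNorm Z + (min m n : ℕ) * β)) := by
    have := mul_le_mul_of_nonneg_left hw (by positivity : 0 ≤ (N / (2 * R)) ^ 2 / 2)
    have e : N / (2 * R) * N - (N / (2 * R)) ^ 2 / 2 * (2 * R) = N ^ 2 / (2 * R) / 2 := by
      rcases hR0.eq_or_lt with h | h
      · simp [← h]
      · field_simp
        ring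
    linarith
  have h2 := mul_le_mul_of_nonneg_left (h1.trans key) hα
  rw [Psi_eq, Psi_eq]
  calc g (X - Z) + α / (2 * R) / 2 * N ^ 2 = g (X - Z) + α * (N ^ 2 / (2 * R) / 2) := by ring
    _ ≤ _ := add_le_add_right h2 _
    _ = _ := by
      simp only [g, IsLinearMap.mk'_apply]
      ring

end Matrix

end SpectralReg

end

theorem theorem3 (m n : ℕ) (α β D : ℝ) (hα : 0 ≤ α) (hβ : 0 < β) (hD : 0 ≤ D) :
    SpectralReg.StronglyConvexWrt SpectralReg.nuclearNorm (SpectralReg.nuclearBall m n D)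
      (α / (2 * (D + (min m n : ℕ) * β))) (SpectralReg.Psi α β) := by
  exact .of_forall_exists (SpectralReg.convex_nuclearBall D) (by positivity)
    (fun _ X hc => SpectralReg.nuclearNorm_smul hc X)
    fun _ hZ => SpectralReg.exists_strong_subgradient hα hβ hD hZ
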